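/- **Lemma (client error of a model trained by gradient descent on proxy data).** Let $X$ be a measurable space, let $\mathcal D^q_1,\dots,\mathcal D^q_R$ (clusters) and $\mathcal D^p$ (client) be probability distributions of labelled examples $(x,y)\in X\times[0,1]$, and let $\alpha_r\in[0,1]$ with $\sum_{r=1}^R\alpha_r=1$. Let $S=((x_1,y_1),\dots,(x_N,y_N))$, $|S|=N\ge 1$, be drawn i.i.d. from the mixture $\sum_{r=1}^R\alpha_r\mathcal D^q_r$. Let $\mathcal H$ be a class of measurable hypotheses $h:X\to[0,1]$ (with $\{0,1\}$-valued classifiers as a special case), and write $$L(h,\mathcal D)=\mathbb E_{(x,y)\sim\mathcal D}|h(x)-y|,\qquad L(h,S)=\frac1N\sum_{i=1}^N|h(x_i)-y_i|$$ for the generalization and the empirical error. Let $\mathcal C$ be the class of decision regions $\{x: h(x)>\beta\}$, $h\in\mathcal H$, $0\le\beta<1$ (for $\{0,1\}$-valued $h$ these are the sets $\{h=1\}$). The VC dimension of $\mathcal H$ is that of $\mathcal C$; assume that it is a finite number $d$. The $\mathcal H\Delta\mathcal H$-divergence is $$d_{\mathcal H\Delta\mathcal H}(\mathcal D,\mathcal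 D')=2\sup_{A,B\in\mathcal C}\bigl|\Pr_{x\sim\mathcal D}[x\in A\,\triangle\,B]-\Pr_{x\sim\mathcal D'}[x\in A\,\triangle\,B]\bigr| .$$ Let $\Theta\subseteq\mathbb R^m$, let $f_\theta\in\mathcal H$ for all $\theta\in\Theta$, let $\theta_0\in\Theta$, $\mu,G>0$, $0<\eta\le 1/G$, $T\in\mathbb N$ and $p\in(0,1)$. Assume that for almost every $S$ the training loss $\theta\mapsto L(f_\theta,S)$ is $\mu$-strongly convex on (the convex set) $\Theta$ and $G$-smooth on $\Theta$ (differentiable at the points of $\Theta$ with $G$-Lipschitz gradient on $\Theta$), and that the gradient descent iterates $\theta_{t+1}=\theta_t-\eta\nabla_\theta L(f_{\theta_t},S)$, started from $\theta_0$, lie in $\Theta$ for $t\le T$. Then, with probability at least $1-p$ over the choice of $S$, $$L(f_{\theta_T},\mathcal D^p)\le(1-\mu\eta)^T\,\ell_0(\theta_0,S)+\frac12\sum_{r=1}^R\alpha_r\,d_{\mathcal H\Delta\mathcal H}(\mathcal D^q_r,\mathcal D^p)+4\sqrt{\frac{2d\log(2N)+\log(4/p)}{N}}+\xi',$$ where $\ell_0(\theta_0,S)=\bigl|L(f_{\theta_0},S)-\inf_{\theta\in\Theta}L(f_\theta,S)\bigr|$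 and $$\xi'=\inf_{\theta\in\Theta}\{L(f_\theta,S)+L(f_\theta,\mathcal D^p)\}+\inf_{\theta\in\Theta}L(f_\theta,S).$$ In particular, for the learning rate $\eta=1/G$ the first factor is $(1-\mu/G)^T$. -/

import Mathlib

open MeasureTheory

namespace ClientError

noncomputable section

/-- The class of sets `𝒞` shatters the finite set `s`: every subset of `s` is cut out of `s` by a
member of `𝒞`. -/
def Shatters {X : Type*} (𝒞 : Set (Set X)) (s : Finset X) : Prop :=
  ∀ t ⊆ s, ∃ A ∈ 𝒞, ∀ x ∈ s, x ∈ A ↔ x ∈ t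

/-- The VC dimension of a class of sets: the supremum of the sizes of the shattered finite sets. -/
def vcDim {X : Type*} (𝒞 : Set (Set X)) : ℕ∞ :=
  ⨆ (s : Finset X) (_ : Shatters 𝒞 s), (s.card : ℕ∞)

/-- The class of decision regions `{x | β < h x}`, `h ∈ ℋ`, `0 ≤ β < 1`, of a class `ℋ` of
hypotheses with values in `[0, 1]`. When all members of `ℋ` are `{0, 1}`-valued, it consists of
the sets `{x | h x = 1}`, `h ∈ ℋ`. -/
def decisionRegions {X : Type*} (ℋ : Set (X → ℝ)) : Set (Set X) :=
  {A | ∃ h ∈ ℋ, ∃ β : ℝ, 0 ≤ β ∧ β < 1 ∧ A = {x | β < h x}}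

/-- The VC dimension of a class of hypotheses with values in `[0, 1]`. -/
def vcDimension {X : Type*} (ℋ : Set (X → ℝ)) : ℕ∞ :=
  vcDim (decisionRegions ℋ)

/-- The disagreement regions `A ∆ B` of two members of a class of sets. -/
def disagreementRegions {X : Type*} (𝒞 : Set (Set X)) : Set (Set X) :=
  {C | ∃ A ∈ 𝒞, ∃ B ∈ 𝒞, C = symmDiff A B}

/-- The divergence `2 sup_{A ∈ 𝒜} |P(A) - Q(A)|` of two distributions, induced by a class `𝒜`
of sets. -/
def classDivergence {X : Type*} [MeasurableSpace X] (𝒜 : Set (Set X)) (P Q : Measure X) : ℝ :=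
  2 * ⨆ A : 𝒜, |P.real (A : Set X) - Q.real (A : Set X)|

/-- The `ℋΔℋ`-divergence of two distributions of labelled examples, that is, of their marginals on
the feature space `X`. -/
def hdhDivergence {X : Type*} [MeasurableSpace X] (ℋ : Set (X → ℝ)) (P Q : Measure (X × ℝ)) : ℝ :=
  classDivergence (disagreementRegions (decisionRegions ℋ)) P.fst Q.fst

/-- Generalization error `E_{(x, y) ∼ D} |h x - y|`. -/
def risk {X : Type*} [MeasurableSpace X] (h : X → ℝ) (D : Measure (X × ℝ)) : ℝ :=
  ∫ z, |h z.1 - z.2| ∂D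

/-- Empirical error of `h` on a labelled dataset of size `N`. -/
def empRisk {X : Type*} {N : ℕ} (h : X → ℝ) (S : Fin N → X × ℝ) : ℝ :=
  (∑ i, |h (S i).1 - (S i).2|) / N

/-- The mixture `∑ r, α r • D r`. -/
def mixture {Z : Type*} [MeasurableSpace Z] {R : ℕ} (α : Fin R → ℝ) (D : Fin R → Measure Z) :
    Measure Z :=
  ∑ r, ENNReal.ofReal (α r) • D r

/-- `F` is `G`-smooth on `Θ`: it is differentiable at the points of `Θ` and its gradient is
`G`-Lipschitz on `Θ`. -/
def IsSmoothOn {E : Type*} [NormedAddCommGroup E] [InnerProductSpace ℝ E] [CompleteSpace E]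
    (Θ : Set E) (G : ℝ) (F : E → ℝ) : Prop :=
  (∀ θ ∈ Θ, DifferentiableAt ℝ F θ) ∧
    ∀ θ ∈ Θ, ∀ θ' ∈ Θ, ‖gradient F θ - gradient F θ'‖ ≤ G * ‖θ - θ'‖

/-- The `t`-th iterate of gradient descent on `F` from `θ₀` with fixed learning rate `η`. -/
def gradDescent {E : Type*} [NormedAddCommGroup E] [InnerProductSpace ℝ E] [CompleteSpace E]
    (F : E → ℝ) (η : ℝ) (θ₀ : E) : ℕ → E
  | 0 => θ₀
  | t + 1 => gradDescent F η θ₀ t - η • gradient F (gradDescent F η θ₀ t)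

/-- The empirical error on the dataset `S`, as a function of the parameter. -/
def trainLoss {X E : Type*} {N : ℕ} (f : E → X → ℝ) (S : Fin N → X × ℝ) : E → ℝ :=
  fun θ => empRisk (f θ) S

/-- The optimal training loss `L* = inf_{θ ∈ Θ} L(f_θ, S)`. -/
def optLoss {X E : Type*} {N : ℕ} (f : E → X → ℝ) (Θ : Set E) (S : Fin N → X × ℝ) : ℝ :=
  ⨅ θ : Θ, trainLoss f S θ

/-- The initial error gap `|L(f_{θ₀}, S) - L*|`. -/
def initialGap {X E : Type*} {N : ℕ} (f : E → X → ℝ) (Θ : Set E) (θ₀ : E)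
    (S : Fin N → X × ℝ) : ℝ :=
  |trainLoss f S θ₀ - optLoss f Θ S|

/-- `ξ' = inf_{θ ∈ Θ} (L(f_θ, S) + L(f_θ, D)) + inf_{θ ∈ Θ} L(f_θ, S)`. -/
def xiPrime {X E : Type*} [MeasurableSpace X] {N : ℕ} (f : E → X → ℝ) (Θ : Set E)
    (S : Fin N → X × ℝ) (D : Measure (X × ℝ)) : ℝ :=
  (⨅ θ : Θ, (trainLoss f S θ + risk (f θ) D)) + optLoss f Θ S

end

end ClientError

/-!
The training error `L(f_θ, S)` controls the client error `L(f_θ, D^p)` by way of a comparison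
hypothesis `f_θ'` and the mixture `Q` of the clusters. The triangle inequality gives
`L(f_θ, D^p) ≤ L(f_θ', D^p) + E_{D^p} |f_θ - f_θ'|`. By the layer-cake formula the disagreement
`E |f_θ - f_θ'|` is an average over thresholds of probabilities of disagreement regions, so passing
from `D^p` to each cluster costs half a divergence (`integral_disagreement_le`), and under `Q` it is
at most `L(f_θ, Q) + L(f_θ', Q)` (`risk_client_le`). Both errors are replaced by empirical ones
through uniform convergence; then `θ` is the last gradient descent iterate, whose training loss is
bounded by linear convergence (`gradDescent_gap_le`), and the infimum over `θ'` is taken.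

Uniform convergence is proved by exponential moments. A ghost sample and random exchanges of the two
samples reduce it to the moment over random signs of signed sums of loss differences
(`measure_exists_deviation_le`). The losses are again averages over thresholds; by convexity of the
exponential, that moment is bounded for one threshold at a time, where by Sauer–Shelah at
most `(2N + 1) ^ d` sets occur on the `2N` points (`exists_majorant`, `card_traces_le`). The
resulting tail `(2N + 1) ^ d * exp (-N ε² / 2)` is at most `p` for `ε` half of the deviation term of
the bound.

No measurability in the parameter is assumed, and the argument by exponential moments works only for
countable families. Smoothness, however, makes `θ ↦ L(f_θ, S)` almost surely continuous on `Θ`,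
hence its mean `L(f_θ, Q)` is continuous as well, and a countable dense set of parameters suffices
(`measure_exists_risk_deviation_le_of_continuous`).
-/

namespace ClientError

/-! ### Gradient descent on a strongly convex smooth function -/

section GradientDescent

variable {E : Type*} [NormedAddCommGroup E] [InnerProductSpace ℝ E] [CompleteSpace E]
  {Θ : Set E} {F : E → ℝ} {μ G η : ℝ} {x y : E}

lemma hasDerivAt_comp_line {v : E} {t : ℝ} (h : DifferentiableAt ℝ F (x + t • v)) :
    HasDerivAt (fun s : ℝ => F (x + s • v)) (inner ℝ (gradient F (x + t • v)) v) t := by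
  have h1 : HasDerivAt (fun s : ℝ => x + s • v) v t := by
    simpa using ((hasDerivAt_id t).smul_const v).const_add x
  have h2 := h.hasGradientAt.hasFDerivAt.comp_hasDerivAt t h1
  exact h2.congr_deriv (by simp)

/-- First-order characterization of strong convexity: `F` lies above its tangent quadratics. -/
lemma strongConvexOn_tangent_le (hF : StrongConvexOn Θ μ F) (hx : x ∈ Θ) (hy : y ∈ Θ)
    (hd : DifferentiableAt ℝ F x) :
    F x + inner ℝ (gradient F x) (y - x) + μ / 2 * ‖y - x‖ ^ 2 ≤ F y := by
  have h1 : HasDerivAt (fun s : ℝ => F (x + s • (y - x))) (inner ℝ (gradient F x) (y - x)) 0 := by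
    have := hasDerivAt_comp_line (F := F) (x := x) (v := y - x) (t := 0) (by simpa using hd)
    simpa using this
  have h2 := h1.tendsto_slope_zero_right
  have h3 : Filter.Tendsto (fun t : ℝ => F y - F x - (1 - t) * (μ / 2 * ‖y - x‖ ^ 2))
      (nhdsWithin 0 (Set.Ioi 0)) (nhds (F y - F x - (1 - 0) * (μ / 2 * ‖y - x‖ ^ 2))) :=
    (Continuous.tendsto (by fun_prop) 0).mono_left nhdsWithin_le_nhds
  have h4 := le_of_tendsto_of_tendsto h2 h3 (by
    filter_upwards [Ioo_mem_nhdsGT (zero_lt_one' ℝ)] with t ht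
    have h5 := hF.2 hx hy (sub_nonneg.2 ht.2.le) ht.1.le (by ring)
    have h6 : (1 - t) • x + t • y = x + t • (y - x) := by
      rw [smul_sub, sub_smul, one_smul]; abel
    rw [h6, norm_sub_rev] at h5
    simp only [smul_eq_mul, zero_add, zero_smul, add_zero] at h5 ⊢
    rw [inv_mul_le_iff₀ ht.1]
    linarith)
  linarith

/-- Descent lemma: a function with `G`-Lipschitz gradient on a convex set lies below its tangent
quadratics of curvature `G`. -/
lemma isSmoothOn_le_tangent (hF : IsSmoothOn Θ G F) (hΘ : Convex ℝ Θ) (hx : x ∈ Θ) (hy : y ∈ Θ) :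
    F y ≤ F x + inner ℝ (gradient F x) (y - x) + G / 2 * ‖y - x‖ ^ 2 := by
  have hseg : ∀ t ∈ Set.Icc (0 : ℝ) 1, x + t • (y - x) ∈ Θ := fun t ht =>
    hΘ.add_smul_sub_mem hx hy ht
  have hderiv : ∀ t ∈ Set.Icc (0 : ℝ) 1, HasDerivAt (fun s : ℝ => F (x + s • (y - x)))
      (inner ℝ (gradient F (x + t • (y - x))) (y - x)) t := fun t ht =>
    hasDerivAt_comp_line (hF.1 _ (hseg t ht))
  have hB : ∀ t : ℝ, HasDerivAt (fun s : ℝ => F x + s * inner ℝ (gradient F x) (y - x)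
      + G / 2 * ‖y - x‖ ^ 2 * s ^ 2)
      (inner ℝ (gradient F x) (y - x) + G / 2 * ‖y - x‖ ^ 2 * (2 * t)) t := by
    intro t
    have h1 := ((hasDerivAt_id t).mul_const (inner ℝ (gradient F x) (y - x))).const_add (F x)
    have h2 := ((hasDerivAt_id t).pow 2).const_mul (G / 2 * ‖y - x‖ ^ 2)
    exact (h1.add h2).congr_deriv (by simp)
  have key := image_le_of_deriv_right_le_deriv_boundary
    (fun t ht => (hderiv t ht).continuousAt.continuousWithinAt)
    (fun t ht => (hderiv t (Set.Ico_subset_Icc_self ht)).hasDerivWithinAt)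
    (by simp) (fun t _ => (hB t).continuousAt.continuousWithinAt)
    (fun t _ => (hB t).hasDerivWithinAt)
    (fun t ht => by
      have h1 := hF.2 _ (hseg t (Set.Ico_subset_Icc_self ht)) x hx
      have h2 := real_inner_le_norm (gradient F (x + t • (y - x)) - gradient F x) (y - x)
      have h3 : ‖x + t • (y - x) - x‖ = t * ‖y - x‖ := by
        rw [add_sub_cancel_left, norm_smul, Real.norm_of_nonneg ht.1]
      rw [h3] at h1
      rw [inner_sub_left] at h2
      nlinarith [mul_le_mul_of_nonneg_right h1 (norm_nonneg (y - x))])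
    (Set.right_mem_Icc.2 zero_le_one)
  simp only [one_smul, one_mul, one_pow, mul_one, add_sub_cancel] at key
  exact key

/-- The Polyak–Łojasiewicz inequality bounds the gap by the squared gradient, and the descent lemma
bounds the decrease of a step from below by it. -/
lemma gradient_step_gap_le (hconv : StrongConvexOn Θ μ F) (hsm : IsSmoothOn Θ G F) (hμ : 0 < μ)
    (hG : 0 < G) (hη : 0 < η) (hηG : η ≤ 1 / G) (hx : x ∈ Θ) (hx' : x - η • gradient F x ∈ Θ)
    {c : ℝ} (hc : ∀ b, (∀ y ∈ Θ, b ≤ F y) → b ≤ c) :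
    F (x - η • gradient F x) - c ≤ (1 - μ * η) * (F x - c) := by
  set g := gradient F x
  have hPL : F x - ‖g‖ ^ 2 / (2 * μ) ≤ c := by
    refine hc _ fun y hy => ?_
    have h1 := strongConvexOn_tangent_le hconv hx hy (hsm.1 x hx)
    have h2 := neg_le_of_abs_le (abs_real_inner_le_norm g (y - x))
    have h3 : 0 ≤ μ / 2 * (‖y - x‖ - ‖g‖ / μ) ^ 2 := by positivity
    have h4 : μ / 2 * (‖y - x‖ - ‖g‖ / μ) ^ 2
        = μ / 2 * ‖y - x‖ ^ 2 - ‖g‖ * ‖y - x‖ + ‖g‖ ^ 2 / (2 * μ) := by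
      field_simp
      ring
    linarith
  have hdesc := isSmoothOn_le_tangent hsm hconv.1 hx hx'
  rw [sub_sub_cancel_left, inner_neg_right, norm_neg, real_inner_smul_right,
    real_inner_self_eq_norm_sq, norm_smul, Real.norm_of_nonneg hη.le] at hdesc
  have h5 : G * η ≤ 1 := by rwa [le_div_iff₀ hG, mul_comm] at hηG
  have h6 : G / 2 * (η * ‖g‖) ^ 2 ≤ η / 2 * ‖g‖ ^ 2 := by
    have := mul_le_mul_of_nonneg_right h5 (by positivity : 0 ≤ η / 2 * ‖g‖ ^ 2)
    linarith
  have h7 : μ * η * (F x - c) ≤ η / 2 * ‖g‖ ^ 2 := by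
    have h8 : μ * η * (F x - c) ≤ μ * η * (‖g‖ ^ 2 / (2 * μ)) := by gcongr; linarith
    have h9 : μ * η * (‖g‖ ^ 2 / (2 * μ)) = η / 2 * ‖g‖ ^ 2 := by field_simp
    linarith
  linarith

/-- Linear convergence of gradient descent to the greatest lower bound `c` of `F` on `Θ`. -/
lemma gradDescent_gap_le (hconv : StrongConvexOn Θ μ F) (hsm : IsSmoothOn Θ G F) (hμ : 0 < μ)
    (hG : 0 < G) (hη : 0 < η) (hηG : η ≤ 1 / G) {θ₀ : E} {T : ℕ}
    (hiter : ∀ t ≤ T, gradDescent F η θ₀ t ∈ Θ) {c : ℝ} (hcF : ∀ y ∈ Θ, c ≤ F y)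
    (hc : ∀ b, (∀ y ∈ Θ, b ≤ F y) → b ≤ c) :
    F (gradDescent F η θ₀ T) - c ≤ (1 - μ * η) ^ T * (F θ₀ - c) := by
  have hstep : ∀ t < T, F (gradDescent F η θ₀ (t + 1)) - c
      ≤ (1 - μ * η) * (F (gradDescent F η θ₀ t) - c) := fun t ht =>
    gradient_step_gap_le hconv hsm hμ hG hη hηG (hiter t ht.le) (hiter (t + 1) ht) hc
  have hnn : ∀ t ≤ T, 0 ≤ F (gradDescent F η θ₀ t) - c := fun t ht =>
    sub_nonneg.2 (hcF _ (hiter t ht))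
  rcases le_or_gt 0 (1 - μ * η) with h | h
  · have : ∀ t ≤ T, F (gradDescent F η θ₀ t) - c ≤ (1 - μ * η) ^ t * (F θ₀ - c) := by
      intro t
      induction t with
      | zero => intro _; simp [gradDescent]
      | succ t ih =>
        intro ht
        calc _ ≤ (1 - μ * η) * (F (gradDescent F η θ₀ t) - c) := hstep t ht
          _ ≤ (1 - μ * η) * ((1 - μ * η) ^ t * (F θ₀ - c)) :=
            mul_le_mul_of_nonneg_left (ih (by omega)) h
          _ = _ := by ring
    exact this T le_rfl
  · -- A negative factor forces all gaps before the last step to vanish.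
    rcases T with _ | T
    · simp [gradDescent]
    · have h0 : F θ₀ - c = 0 := by
        have h1 := hstep 0 (Nat.succ_pos T)
        have h2 := hnn 1 (by omega)
        have h3 := hnn 0 (Nat.zero_le _)
        simp only [zero_add] at h1
        change 0 ≤ F θ₀ - c at h3
        change _ ≤ (1 - μ * η) * (F θ₀ - c) at h1
        nlinarith
      rw [h0, mul_zero]
      exact (hstep T (Nat.lt_succ_self T)).trans
        (mul_nonpos_of_nonpos_of_nonneg h.le (hnn T (Nat.le_succ T)))

end GradientDescent

/-! ### Thresholds -/

section Thresholds

/-- The disagreement of the threshold indicators `1[β < u]` and `1[β < v]`. -/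
noncomputable def thr (u v β : ℝ) : ℝ := if (β < u ↔ β < v) then 0 else 1

lemma thr_mem_Icc (u v β : ℝ) : thr u v β ∈ Set.Icc (0 : ℝ) 1 := by
  unfold thr; split_ifs <;> simp

lemma measurable_thr {Z : Type*} [MeasurableSpace Z] {u v b : Z → ℝ} (hu : Measurable u)
    (hv : Measurable v) (hb : Measurable b) : Measurable fun z => thr (u z) (v z) (b z) := by
  unfold thr
  refine Measurable.ite ?_ measurable_const measurable_const
  exact (measurableSet_lt hb hu).iff (measurableSet_lt hb hv)

instance : IsProbabilityMeasure (volume.restrict (Set.Ico (0 : ℝ) 1)) :=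
  ⟨by simp⟩

/-- Layer-cake formula for the distance of two numbers in the unit interval. -/
lemma abs_sub_eq_integral_thr {u v : ℝ} (hu : u ∈ Set.Icc (0 : ℝ) 1) (hv : v ∈ Set.Icc (0 : ℝ) 1) :
    |u - v| = ∫ β in Set.Ico (0 : ℝ) 1, thr u v β := by
  have h1 : thr u v = (Set.Ico (min u v) (max u v)).indicator 1 := by
    funext β
    by_cases h : β ∈ Set.Ico (min u v) (max u v)
    · rw [Set.indicator_of_mem h, thr, if_neg]
      · rfl
      · have := h.1; have := h.2; grind
    · rw [Set.indicator_of_notMem h, thr, if_pos]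
      simp only [Set.mem_Ico, not_and, not_lt] at h; grind
  rw [h1, integral_indicator_one measurableSet_Ico, measureReal_restrict_apply measurableSet_Ico,
    Set.inter_eq_left.2, Real.volume_real_Ico_of_le min_le_max, max_sub_min_eq_abs']
  exact Set.Ico_subset_Ico (le_min hu.1 hv.1) (max_le hu.2 hv.2)

lemma integral_abs_sub_eq {Y : Type*} [MeasurableSpace Y] (P : Measure Y) [IsProbabilityMeasure P]
    {u v : Y → ℝ} (hu : Measurable u) (hv : Measurable v) (hu' : ∀ y, u y ∈ Set.Icc (0 : ℝ) 1)
    (hv' : ∀ y, v y ∈ Set.Icc (0 : ℝ) 1) :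
    ∫ y, |u y - v y| ∂P
      = ∫ β in Set.Ico (0 : ℝ) 1, P.real (symmDiff {y | β < u y} {y | β < v y}) := by
  simp_rw [abs_sub_eq_integral_thr (hu' _) (hv' _)]
  rw [integral_integral_swap]
  · refine integral_congr_ae (ae_of_all _ fun β => ?_)
    have hm : MeasurableSet (symmDiff {y | β < u y} {y | β < v y}) :=
      (measurableSet_lt measurable_const hu).symmDiff (measurableSet_lt measurable_const hv)
    simp only
    rw [← integral_indicator_one hm]
    congr 1
    funext y
    simp only [thr, Set.indicator, Set.mem_symmDiff, Set.mem_ofPred_eq, Pi.one_apply]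
    grind
  · refine Integrable.of_bound (C := 1) ?_ (ae_of_all _ fun z => ?_)
    · exact (measurable_thr (hu.comp measurable_fst) (hv.comp measurable_fst)
        measurable_snd).aestronglyMeasurable
    · have := thr_mem_Icc (u z.1) (v z.1) z.2
      simpa [Function.uncurry, abs_of_nonneg this.1] using this.2

end Thresholds

/-! ### The divergence and the disagreement of two hypotheses -/

section Divergence

variable {X : Type*} [MeasurableSpace X] {ℋ : Set (X → ℝ)}

lemma abs_sub_le_classDivergence {𝒜 : Set (Set X)} (P Q : Measure X) [IsProbabilityMeasure P]
    [IsProbabilityMeasure Q] {A : Set X} (hA : A ∈ 𝒜) :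
    |P.real A - Q.real A| ≤ classDivergence 𝒜 P Q / 2 := by
  rw [classDivergence, mul_div_cancel_left₀ _ two_ne_zero]
  refine le_ciSup (f := fun A : 𝒜 => |P.real (A : Set X) - Q.real (A : Set X)|)
    ⟨1, ?_⟩ (⟨A, hA⟩ : 𝒜)
  rintro _ ⟨B, rfl⟩
  exact abs_sub_le_of_nonneg_of_le measureReal_nonneg measureReal_le_one measureReal_nonneg
    measureReal_le_one

lemma integral_disagreement_le (hm : ∀ h ∈ ℋ, Measurable h)
    (hr : ∀ h ∈ ℋ, ∀ x, h x ∈ Set.Icc (0 : ℝ) 1) (P Q : Measure (X × ℝ)) [IsProbabilityMeasure P]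
    [IsProbabilityMeasure Q] {h h' : X → ℝ} (hh : h ∈ ℋ) (hh' : h' ∈ ℋ) :
    ∫ z, |h z.1 - h' z.1| ∂P ≤ ∫ z, |h z.1 - h' z.1| ∂Q + hdhDivergence ℋ Q P / 2 := by
  have hfst : ∀ D : Measure (X × ℝ), [IsProbabilityMeasure D] →
      ∫ z, |h z.1 - h' z.1| ∂D = ∫ β in Set.Ico (0 : ℝ) 1,
        D.fst.real (symmDiff {y | β < h y} {y | β < h' y}) := by
    intro D _
    rw [← integral_abs_sub_eq D.fst (hm h hh) (hm h' hh') (hr h hh) (hr h' hh'), Measure.fst,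
      integral_map measurable_fst.aemeasurable]
    exact ((hm h hh).sub (hm h' hh')).abs.aestronglyMeasurable
  have hint : ∀ D : Measure (X × ℝ), [IsProbabilityMeasure D] →
      Integrable (fun β => D.fst.real (symmDiff {y | β < h y} {y | β < h' y}))
        (volume.restrict (Set.Ico (0 : ℝ) 1)) := by
    intro D _
    refine Integrable.of_bound (C := 1) ?_ (ae_of_all _ fun β => ?_)
    · have hs : MeasurableSet {z : ℝ × X | z.2 ∈ symmDiff {y | z.1 < h y} {y | z.1 < h' y}} :=
        (measurableSet_lt measurable_fst ((hm h hh).comp measurable_snd)).symmDiff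
          (measurableSet_lt measurable_fst ((hm h' hh').comp measurable_snd))
      exact (measurable_measure_prodMk_left hs).ennreal_toReal.aestronglyMeasurable
    · rw [Real.norm_of_nonneg measureReal_nonneg]
      exact measureReal_le_one
  rw [hfst P, hfst Q]
  have hc : hdhDivergence ℋ Q P / 2
      = ∫ β in Set.Ico (0 : ℝ) 1, hdhDivergence ℋ Q P / 2 := by simp
  rw [hc, ← integral_add (hint Q) (integrable_const _)]
  refine setIntegral_mono_on (hint P) ((hint Q).add (integrable_const _)) measurableSet_Ico
    fun β hβ => ?_
  have h1 := abs_sub_le_classDivergence (𝒜 := disagreementRegions (decisionRegions ℋ)) Q.fst P.fst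
    (A := symmDiff {y | β < h y} {y | β < h' y})
    ⟨_, ⟨h, hh, β, hβ.1, hβ.2, rfl⟩, _, ⟨h', hh', β, hβ.1, hβ.2, rfl⟩, rfl⟩
  have h2 := neg_le_of_abs_le h1
  change _ ≤ Q.fst.real _ + hdhDivergence ℋ Q P / 2
  unfold hdhDivergence
  linarith

end Divergence

/-! ### Sauer–Shelah bound for the traces of a class on a finite sequence -/

section Traces

lemma sum_choose_le (n d : ℕ) : ∑ k ∈ Finset.Iic d, n.choose k ≤ (n + 1) ^ d := by
  have : Finset.Iic d = Finset.range (d + 1) := by ext; simp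
  rw [add_pow, this]
  refine Finset.sum_le_sum fun k hk => ?_
  have hk' : k ≤ d := Nat.lt_succ_iff.1 (Finset.mem_range.1 hk)
  rw [one_pow, mul_one]
  exact (Nat.choose_le_pow n k).trans (Nat.le_mul_of_pos_right _ (Nat.choose_pos hk'))

open scoped Classical in
/-- The index sets of the points of the finite sequence `w` that lie in a member of `𝒞`. -/
noncomputable def traces {X J : Type*} [Fintype J] (𝒞 : Set (Set X)) (w : J → X) :
    Finset (Finset J) :=
  {t | ∃ A ∈ 𝒞, ∀ j, j ∈ t ↔ w j ∈ A}

lemma card_traces_le {X J : Type*} [Fintype J] {𝒞 : Set (Set X)} {d : ℕ} (hd : vcDim 𝒞 ≤ d)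
    (w : J → X) : (traces 𝒞 w).card ≤ (Fintype.card J + 1) ^ d := by
  classical
  have hvc : (traces 𝒞 w).vcDim ≤ d := by
    refine Finset.sup_le fun s hs => ?_
    rw [Finset.mem_shatterer] at hs
    have hinj : Set.InjOn w s := by
      intro i hi j hj hij
      obtain ⟨u, hu, hsu⟩ := hs (Finset.singleton_subset_iff.2 hi)
      simp only [traces, Finset.mem_filter, Finset.mem_univ, true_and] at hu
      obtain ⟨A, _, hA⟩ := hu
      have hiu : i ∈ s ∩ u := by simp [hsu]
      have hju : j ∈ s ∩ u := by
        refine Finset.mem_inter.2 ⟨hj, ?_⟩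
        rw [hA, ← hij, ← hA]
        exact (Finset.mem_inter.1 hiu).2
      rw [hsu, Finset.mem_singleton] at hju
      exact hju.symm
    have hsh : Shatters 𝒞 (s.image w) := by
      intro t ht
      obtain ⟨u, hu, hsu⟩ := hs (Finset.filter_subset (fun j => w j ∈ t) s)
      simp only [traces, Finset.mem_filter, Finset.mem_univ, true_and] at hu
      obtain ⟨A, hA, hAu⟩ := hu
      refine ⟨A, hA, ?_⟩
      simp only [Finset.mem_image, forall_exists_index, and_imp, forall_apply_eq_imp_iff₂]
      intro j hj
      rw [← hAu]
      have := Finset.ext_iff.1 hsu j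
      simpa [hj] using this
    have h1 : ((s.image w).card : ℕ∞) ≤ vcDim 𝒞 :=
      le_iSup₂_of_le (f := fun (s : Finset X) (_ : Shatters 𝒞 s) => (s.card : ℕ∞)) _ hsh le_rfl
    rw [Finset.card_image_of_injOn hinj] at h1
    exact_mod_cast h1.trans hd
  calc _ ≤ (traces 𝒞 w).shatterer.card := Finset.card_le_card_shatterer _
    _ ≤ ∑ k ∈ Finset.Iic (traces 𝒞 w).vcDim, (Fintype.card J).choose k :=
      Finset.card_shatterer_le_sum_vcDim
    _ ≤ ∑ k ∈ Finset.Iic d, (Fintype.card J).choose k :=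
      Finset.sum_le_sum_of_subset (Finset.Iic_subset_Iic.2 hvc)
    _ ≤ _ := sum_choose_le _ _

end Traces

/-! ### Exponential moments of signed sums -/

section Signs

variable {ι : Type*} [Fintype ι] [DecidableEq ι]

/-- The sign `±1` encoded by a Boolean. -/
def sgn (b : Bool) : ℝ := if b then 1 else -1

lemma sum_exp_sgn_le (c : ℝ) {b : ι → ℝ} (hb : ∀ i, |b i| ≤ 1) :
    ∑ σ : ι → Bool, Real.exp (c * ∑ i, sgn (σ i) * b i)
      ≤ 2 ^ Fintype.card ι * Real.exp (Fintype.card ι * (c ^ 2 / 2)) := by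
  have h1 : ∀ σ : ι → Bool, Real.exp (c * ∑ i, sgn (σ i) * b i)
      = ∏ i, Real.exp (c * (sgn (σ i) * b i)) := fun σ => by
    rw [← Real.exp_sum, Finset.mul_sum]
  simp_rw [h1]
  rw [← Fintype.piFinset_univ,
    ← Finset.prod_univ_sum (fun _ => Finset.univ) fun i s => Real.exp (c * (sgn s * b i))]
  have h2 : ∀ i ∈ Finset.univ, ∑ s : Bool, Real.exp (c * (sgn s * b i))
      ≤ 2 * Real.exp (c ^ 2 / 2) := by
    intro i _
    have h3 : ∑ s : Bool, Real.exp (c * (sgn s * b i)) = 2 * Real.cosh (c * b i) := by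
      rw [Real.cosh_eq, Fintype.sum_bool]
      simp only [sgn, if_true, Bool.false_eq_true, if_false]
      ring_nf
    rw [h3]
    gcongr
    refine (Real.cosh_le_exp_half_sq _).trans (Real.exp_le_exp.2 ?_)
    have h4 : b i ^ 2 ≤ 1 := (sq_le_one_iff_abs_le_one _).2 (hb i)
    nlinarith [mul_le_mul_of_nonneg_left h4 (sq_nonneg c)]
  refine (Finset.prod_le_prod (fun i _ => by positivity) h2).trans_eq ?_
  rw [Finset.prod_const, Finset.card_univ, mul_pow, Real.exp_nat_mul]

/-- Let the functions `u k` on the `2 |ι|` points `(i, true)`, `(i, false)` cut out only the sets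
in `𝒜` at the thresholds in `[0, 1)`. Then the exponential moment over random signs of the signed
sums of loss differences, maximized over `k`, is at most `|𝒜|` times the bound for a single `k`.
The thresholds are averaged by Jensen's inequality, hence cost no union bound. -/
lemma exists_majorant {κ : Type*} (𝒜 : Finset (Finset (ι × Bool))) {u : κ → ι × Bool → ℝ}
    {v : ι × Bool → ℝ} (hu : ∀ k j, u k j ∈ Set.Icc (0 : ℝ) 1) (hv : ∀ j, v j ∈ Set.Icc (0 : ℝ) 1)
    (h𝒜 : ∀ k, ∀ β ∈ Set.Ico (0 : ℝ) 1, ∃ A ∈ 𝒜, ∀ j, j ∈ A ↔ β < u k j) (c : ℝ) :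
    ∃ B : (ι → Bool) → ℝ,
      (∀ σ k, Real.exp (c * ∑ i, sgn (σ i) *
        (|u k (i, true) - v (i, true)| - |u k (i, false) - v (i, false)|)) ≤ B σ) ∧
      ∑ σ, B σ ≤ 2 ^ Fintype.card ι * (𝒜.card * Real.exp (Fintype.card ι * (c ^ 2 / 2))) := by
  classical
  let dis : Finset (ι × Bool) → ℝ → ι × Bool → ℝ := fun A β j => if (j ∈ A ↔ β < v j) then 0 else 1
  let b : Finset (ι × Bool) → ℝ → ι → ℝ := fun A β i => dis A β (i, true) - dis A β (i, false)
  have hb : ∀ A β i, |b A β i| ≤ 1 := by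
    intro A β i
    simp only [b, dis]
    split_ifs <;> norm_num
  have hbm : ∀ A i, Measurable fun β => b A β i := by
    intro A i
    have : ∀ j, Measurable fun β => dis A β j := fun j =>
      Measurable.ite ((MeasurableSet.const (j ∈ A)).iff
        (measurableSet_lt measurable_id measurable_const)) measurable_const measurable_const
    exact (this _).sub (this _)
  have hsum : ∀ (σ : ι → Bool) (a : ι → ℝ), (∀ i, |a i| ≤ 1) →
      |∑ i, sgn (σ i) * a i| ≤ Fintype.card ι := by
    intro σ a ha
    refine (Finset.abs_sum_le_sum_abs _ _).trans ?_
    refine (Finset.sum_le_card_nsmul _ _ 1 fun i _ => ?_).trans_eq (by simp)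
    rw [abs_mul]
    have : |sgn (σ i)| = 1 := by cases σ i <;> simp [sgn]
    rw [this, one_mul]; exact ha i
  have hbound : ∀ (σ : ι → Bool) (a : ι → ℝ), (∀ i, |a i| ≤ 1) →
      ‖Real.exp (c * ∑ i, sgn (σ i) * a i)‖ ≤ Real.exp (|c| * Fintype.card ι) := by
    intro σ a ha
    rw [Real.norm_of_nonneg (Real.exp_pos _).le, Real.exp_le_exp]
    refine (le_abs_self _).trans ?_
    rw [abs_mul]
    exact mul_le_mul_of_nonneg_left (hsum σ a ha) (abs_nonneg c)
  have hint : ∀ A (σ : ι → Bool), Integrable (fun β => Real.exp (c * ∑ i, sgn (σ i) * b A β i))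
      (volume.restrict (Set.Ico (0 : ℝ) 1)) := by
    intro A σ
    refine Integrable.of_bound (C := Real.exp (|c| * Fintype.card ι)) ?_
      (ae_of_all _ fun β => hbound σ _ (hb A β))
    refine Measurable.aestronglyMeasurable (Real.measurable_exp.comp (Measurable.const_mul ?_ c))
    exact Finset.measurable_sum _ fun i _ => (hbm A i).const_mul _
  refine ⟨fun σ => ∫ β in Set.Ico (0 : ℝ) 1, ∑ A ∈ 𝒜, Real.exp (c * ∑ i, sgn (σ i) * b A β i),
    fun σ k => ?_, ?_⟩
  · let a : ℝ → ι → ℝ := fun β i =>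
      thr (u k (i, true)) (v (i, true)) β - thr (u k (i, false)) (v (i, false)) β
    have ha : ∀ β i, |a β i| ≤ 1 := by
      intro β i
      have h1 := thr_mem_Icc (u k (i, true)) (v (i, true)) β
      have h2 := thr_mem_Icc (u k (i, false)) (v (i, false)) β
      exact abs_sub_le_of_nonneg_of_le h1.1 h1.2 h2.1 h2.2
    have htm : ∀ j, Measurable fun β => thr (u k j) (v j) β := fun j =>
      measurable_thr measurable_const measurable_const measurable_id
    have hti : ∀ j, Integrable (fun β => thr (u k j) (v j) β)
        (volume.restrict (Set.Ico (0 : ℝ) 1)) := by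
      intro j
      refine Integrable.of_bound (C := 1) (htm j).aestronglyMeasurable (ae_of_all _ fun β => ?_)
      have := thr_mem_Icc (u k j) (v j) β
      rw [Real.norm_of_nonneg this.1]; exact this.2
    have hai : Integrable (fun β => c * ∑ i, sgn (σ i) * a β i)
        (volume.restrict (Set.Ico (0 : ℝ) 1)) :=
      (integrable_finsetSum _ fun i _ => ((hti _).sub (hti _)).const_mul _).const_mul _
    have hei : Integrable (fun β => Real.exp (c * ∑ i, sgn (σ i) * a β i))
        (volume.restrict (Set.Ico (0 : ℝ) 1)) :=
      Integrable.of_bound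
        (Real.measurable_exp.comp_aemeasurable hai.aemeasurable).aestronglyMeasurable _ (ae_of_all _ fun β => hbound σ _ (ha β))
    have h1 : c * ∑ i, sgn (σ i) *
        (|u k (i, true) - v (i, true)| - |u k (i, false) - v (i, false)|)
        = ∫ β in Set.Ico (0 : ℝ) 1, c * ∑ i, sgn (σ i) * a β i := by
      rw [integral_const_mul, integral_finsetSum]
      · congr 1
        refine Finset.sum_congr rfl fun i _ => ?_
        rw [integral_const_mul, integral_sub (hti _) (hti _),
          ← abs_sub_eq_integral_thr (hu _ _) (hv _), ← abs_sub_eq_integral_thr (hu _ _) (hv _)]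
      · exact fun i _ => ((hti _).sub (hti _)).const_mul _
    rw [h1]
    refine (convexOn_exp.map_integral_le Real.continuous_exp.continuousOn isClosed_univ
      (ae_of_all _ fun _ => Set.mem_univ _) hai hei).trans ?_
    refine setIntegral_mono_on hei (integrable_finsetSum _ fun A _ => hint A σ)
      measurableSet_Ico fun β hβ => ?_
    obtain ⟨A, hA, hAu⟩ := h𝒜 k β hβ
    have h2 : a β = b A β := by
      funext i
      simp only [a, b, dis, thr, hAu]
    rw [h2]
    exact Finset.single_le_sum (f := fun A => Real.exp (c * ∑ i, sgn (σ i) * b A β i))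
      (fun _ _ => (Real.exp_pos _).le) hA
  · rw [← integral_finsetSum _ fun σ _ => integrable_finsetSum _ fun A _ => hint A σ]
    have h3 : ∀ β, ∑ σ : ι → Bool, ∑ A ∈ 𝒜, Real.exp (c * ∑ i, sgn (σ i) * b A β i)
        ≤ 2 ^ Fintype.card ι * (𝒜.card * Real.exp (Fintype.card ι * (c ^ 2 / 2))) := by
      intro β
      rw [Finset.sum_comm]
      refine (Finset.sum_le_card_nsmul _ _ _ fun A _ => sum_exp_sgn_le c (hb A β)).trans_eq ?_
      rw [nsmul_eq_mul]
      ring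
    refine (integral_mono (integrable_finsetSum _ fun σ _ => integrable_finsetSum _
      fun A _ => hint A σ) (integrable_const _) h3).trans_eq ?_
    simp

end Signs

/-! ### Uniform deviation bound by symmetrization -/

section Symmetrization

variable {Z : Type*} [MeasurableSpace Z] {N : ℕ}

/-- Exchanging the two components of a pair when the sign is `-1`. -/
def signSwap (s : Bool) (z : Z × Z) : Z × Z := if s then z else z.swap

lemma measurePreserving_signSwap (P : Measure Z) [IsProbabilityMeasure P] (σ : Fin N → Bool) :
    MeasurePreserving (fun (ω : Fin N → Z × Z) i => signSwap (σ i) (ω i))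
      (Measure.pi fun _ => P.prod P) (Measure.pi fun _ => P.prod P) := by
  refine measurePreserving_pi (f := fun i => signSwap (σ i)) _ _ fun i => ?_
  unfold signSwap
  cases σ i
  · simpa using Measure.measurePreserving_swap
  · exact MeasurePreserving.id _

variable {κ : Type*} [Countable κ] {φ : κ → Z → ℝ}

/-- The maximal exponential moment `sup_k exp (c ∑ᵢ (φ k zᵢ' - φ k zᵢ))` of a sample of pairs
`(zᵢ, zᵢ')`. -/
noncomputable def maxExp (φ : κ → Z → ℝ) (c : ℝ) (ω : Fin N → Z × Z) : ENNReal :=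
  ⨆ k, ENNReal.ofReal (Real.exp (c * ∑ i, (φ k (ω i).2 - φ k (ω i).1)))

lemma measurable_maxExp (hφ : ∀ k, Measurable (φ k)) (c : ℝ) :
    Measurable (maxExp φ c : (Fin N → Z × Z) → ENNReal) := by
  refine Measurable.iSup fun k => ENNReal.measurable_ofReal.comp (Real.measurable_exp.comp
    (Measurable.const_mul (Finset.measurable_sum _ fun i _ => ?_) c))
  exact ((hφ k).comp (measurable_snd.comp (measurable_pi_apply i))).sub
    ((hφ k).comp (measurable_fst.comp (measurable_pi_apply i)))

/-- Averaging over exchanges of the two components of the pairs, which preserve the law of the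
sample, reduces the moment to one over random signs. -/
lemma lintegral_maxExp_le (P : Measure Z) [IsProbabilityMeasure P] (hφ : ∀ k, Measurable (φ k))
    {c M : ℝ} (hM : ∀ ω : Fin N → Z × Z, ∃ B : (Fin N → Bool) → ℝ,
      (∀ σ k, Real.exp (c * ∑ i, sgn (σ i) * (φ k (ω i).2 - φ k (ω i).1)) ≤ B σ) ∧
      ∑ σ, B σ ≤ 2 ^ N * M) :
    ∫⁻ ω : Fin N → Z × Z, maxExp φ c ω ∂(Measure.pi fun _ => P.prod P) ≤ ENNReal.ofReal M := by
  have hmeas := measurable_maxExp (N := N) hφ c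
  have h1 : (2 ^ N : ENNReal) * ∫⁻ ω, maxExp φ c ω ∂(Measure.pi fun _ : Fin N => P.prod P)
      ≤ 2 ^ N * ENNReal.ofReal M := by
    calc (2 ^ N : ENNReal) * ∫⁻ ω, maxExp φ c ω ∂(Measure.pi fun _ : Fin N => P.prod P)
        = ∑ σ : Fin N → Bool, ∫⁻ ω, maxExp φ c (fun i => signSwap (σ i) (ω i))
            ∂(Measure.pi fun _ => P.prod P) := by
          simp_rw [(measurePreserving_signSwap P _).lintegral_comp hmeas]
          simp
      _ = ∫⁻ ω, ∑ σ : Fin N → Bool, maxExp φ c (fun i => signSwap (σ i) (ω i))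
            ∂(Measure.pi fun _ => P.prod P) :=
          (lintegral_finsetSum _ fun σ _ =>
            hmeas.comp (measurePreserving_signSwap P σ).measurable).symm
      _ ≤ ∫⁻ _ω : Fin N → Z × Z, 2 ^ N * ENNReal.ofReal M ∂(Measure.pi fun _ => P.prod P) := by
          refine lintegral_mono fun ω => ?_
          obtain ⟨B, hB, hBM⟩ := hM ω
          rcases isEmpty_or_nonempty κ with hκ | ⟨⟨k₀⟩⟩
          · simp [maxExp]
          have hB0 : ∀ σ, 0 ≤ B σ := fun σ => (Real.exp_pos _).le.trans (hB σ k₀)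
          calc ∑ σ : Fin N → Bool, maxExp φ c (fun i => signSwap (σ i) (ω i))
              ≤ ∑ σ, ENNReal.ofReal (B σ) := by
                refine Finset.sum_le_sum fun σ _ => iSup_le fun k => ENNReal.ofReal_le_ofReal ?_
                refine le_trans (le_of_eq ?_) (hB σ k)
                congr 2
                refine Finset.sum_congr rfl fun i _ => ?_
                rcases hσ : σ i <;> simp [signSwap, sgn, hσ]
            _ = ENNReal.ofReal (∑ σ, B σ) :=
                (ENNReal.ofReal_sum_of_nonneg fun σ _ => hB0 σ).symm
            _ ≤ ENNReal.ofReal (2 ^ N * M) := ENNReal.ofReal_le_ofReal hBM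
            _ = 2 ^ N * ENNReal.ofReal M := by
                rw [ENNReal.ofReal_mul (by positivity), ENNReal.ofReal_pow two_pos.le]
                simp
      _ = 2 ^ N * ENNReal.ofReal M := by simp
  exact (ENNReal.mul_le_mul_iff_right (by simp) (by simp)).1 h1

/-- Uniform one-sided deviation bound: comparison with an independent ghost sample, by Jensen's
inequality, followed by Markov's inequality. -/
lemma measure_exists_deviation_le (P : Measure Z) [IsProbabilityMeasure P]
    (hφ : ∀ k, Measurable (φ k)) (hφ01 : ∀ k z, φ k z ∈ Set.Icc (0 : ℝ) 1) {c M ε : ℝ} (hc : 0 < c)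
    (hN : 0 < N)
    (hM : ∀ ω : Fin N → Z × Z, ∃ B : (Fin N → Bool) → ℝ,
      (∀ σ k, Real.exp (c * ∑ i, sgn (σ i) * (φ k (ω i).2 - φ k (ω i).1)) ≤ B σ) ∧
      ∑ σ, B σ ≤ 2 ^ N * M) :
    (Measure.pi fun _ : Fin N => P) {S | ∃ k, ε < ∫ z, φ k z ∂P - (∑ i, φ k (S i)) / N}
      ≤ ENNReal.ofReal (M * Real.exp (-(c * (N * ε)))) := by
  have hN' : (0 : ℝ) < N := Nat.cast_pos.2 hN
  have hint : ∀ k, Integrable (φ k) P := fun k =>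
    Integrable.of_bound (C := 1) (hφ k).aestronglyMeasurable (ae_of_all _ fun z => by
      rw [Real.norm_of_nonneg (hφ01 k z).1]; exact (hφ01 k z).2)
  have hinti : ∀ k (i : Fin N), Integrable (fun S : Fin N → Z => φ k (S i))
      (Measure.pi fun _ => P) := fun k i =>
    (measurePreserving_eval (fun _ : Fin N => P) i).integrable_comp_of_integrable (hint k)
  let g : (Fin N → Z) → ENNReal := fun S =>
    ⨆ k, ENNReal.ofReal (Real.exp (c * ∑ i, (∫ z, φ k z ∂P - φ k (S i))))
  have hg : Measurable g := by
    refine Measurable.iSup fun k => ENNReal.measurable_ofReal.comp (Real.measurable_exp.comp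
      (Measurable.const_mul (Finset.measurable_sum _ fun i _ => ?_) c))
    exact measurable_const.sub ((hφ k).comp (measurable_pi_apply i))
  have hghost : ∫⁻ S, g S ∂(Measure.pi fun _ => P) ≤ ENNReal.ofReal M := by
    refine le_trans ?_ (lintegral_maxExp_le P hφ hM)
    have hmp := measurePreserving_arrowProdEquivProdArrow Z Z (Fin N) (fun _ => P) (fun _ => P)
    let H : (Fin N → Z) × (Fin N → Z) → ENNReal := fun p => maxExp φ c fun i => (p.1 i, p.2 i)
    have hH : Measurable H := (measurable_maxExp hφ c).comp (measurable_pi_lambda _ fun i =>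
      ((measurable_pi_apply i).comp measurable_fst).prodMk
        ((measurable_pi_apply i).comp measurable_snd))
    have h1 : ∫⁻ ω : Fin N → Z × Z, maxExp φ c ω ∂(Measure.pi fun _ => P.prod P)
        = ∫⁻ S, ∫⁻ S', H (S, S') ∂(Measure.pi fun _ => P) ∂(Measure.pi fun _ => P) := by
      rw [← lintegral_prod _ hH.aemeasurable, ← hmp.lintegral_comp hH]
      rfl
    rw [h1]
    refine lintegral_mono fun S => iSup_le fun k => ?_
    let q : (Fin N → Z) → ℝ := fun S' => c * ∑ i, (φ k (S' i) - φ k (S i))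
    have hqi : Integrable q (Measure.pi fun _ => P) :=
      (integrable_finsetSum _ fun i _ => (hinti k i).sub (integrable_const _)).const_mul c
    have hqb : ∀ S', q S' ≤ c * N := by
      intro S'
      refine mul_le_mul_of_nonneg_left ?_ hc.le
      refine (Finset.sum_le_card_nsmul _ _ 1 fun i _ => ?_).trans_eq (by simp)
      linarith [(hφ01 k (S' i)).2, (hφ01 k (S i)).1]
    have hei : Integrable (fun S' => Real.exp (q S')) (Measure.pi fun _ => P) :=
      Integrable.of_bound (C := Real.exp (c * N))
        (Real.measurable_exp.comp_aemeasurable hqi.aemeasurable).aestronglyMeasurable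
        (ae_of_all _ fun S' => by
          rw [Real.norm_of_nonneg (Real.exp_pos _).le]
          exact Real.exp_le_exp.2 (hqb S'))
    have h2 : c * ∑ i, (∫ z, φ k z ∂P - φ k (S i)) = ∫ S', q S' ∂(Measure.pi fun _ => P) := by
      simp only [q]
      rw [integral_const_mul, integral_finsetSum _ fun i _ => by
        exact (hinti k i).sub (integrable_const _)]
      congr 1
      refine Finset.sum_congr rfl fun i _ => ?_
      rw [integral_sub (hinti k i) (integrable_const _), integral_const]
      have h3 := integral_map (μ := Measure.pi fun _ : Fin N => P) (f := φ k)
        (measurable_pi_apply i).aemeasurable (hφ k).aestronglyMeasurable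
      have h4 := (measurePreserving_eval (fun _ : Fin N => P) i).map_eq
      change Measure.map (fun S : Fin N → Z => S i) _ = P at h4
      rw [h4] at h3
      rw [h3]
      simp
    rw [h2]
    refine (ENNReal.ofReal_le_ofReal (convexOn_exp.map_integral_le
      Real.continuous_exp.continuousOn isClosed_univ (ae_of_all _ fun _ => Set.mem_univ _)
      hqi hei)).trans ?_
    rw [ofReal_integral_eq_lintegral_ofReal hei (ae_of_all _ fun _ => (Real.exp_pos _).le)]
    exact lintegral_mono fun S' => le_iSup (fun k => ENNReal.ofReal
      (Real.exp (c * ∑ i, (φ k (S' i) - φ k (S i))))) k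
  set e : ENNReal := ENNReal.ofReal (Real.exp (c * (N * ε))) with he
  have hsub : {S : Fin N → Z | ∃ k, ε < ∫ z, φ k z ∂P - (∑ i, φ k (S i)) / N}
      ⊆ {S | e ≤ g S} := by
    rintro S ⟨k, hk⟩
    refine le_trans ?_ (le_iSup (fun k => ENNReal.ofReal
      (Real.exp (c * ∑ i, (∫ z, φ k z ∂P - φ k (S i))))) k)
    refine ENNReal.ofReal_le_ofReal (Real.exp_le_exp.2 (mul_le_mul_of_nonneg_left ?_ hc.le))
    rw [Finset.sum_sub_distrib, Finset.sum_const, Finset.card_univ, Fintype.card_fin,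
      nsmul_eq_mul]
    have h5 : (N : ℝ) * (∫ z, φ k z ∂P - (∑ i, φ k (S i)) / N)
        = N * ∫ z, φ k z ∂P - ∑ i, φ k (S i) := by
      field_simp
    rw [← h5]
    exact mul_le_mul_of_nonneg_left hk.le hN'.le
  have hmarkov := (mul_meas_ge_le_lintegral hg e).trans hghost
  rw [mul_comm] at hmarkov
  have he0 : e ≠ 0 := by simp [he, Real.exp_pos]
  refine (measure_mono hsub).trans ((ENNReal.le_div_iff_mul_le (Or.inl he0)
    (Or.inl ENNReal.ofReal_ne_top)).2 hmarkov |>.trans_eq ?_)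
  rw [he, ← ENNReal.ofReal_div_of_pos (Real.exp_pos _), Real.exp_neg, div_eq_mul_inv]

end Symmetrization

/-! ### Uniform convergence over a class of finite VC dimension -/

section UniformConvergence

variable {X : Type*} [MeasurableSpace X] {ℋ : Set (X → ℝ)} {N : ℕ}

lemma integrable_loss (P : Measure (X × ℝ)) [IsFiniteMeasure P] {h : X → ℝ} (hm : Measurable h)
    (hr : ∀ x, h x ∈ Set.Icc (0 : ℝ) 1) (hP : ∀ᵐ z ∂P, z.2 ∈ Set.Icc (0 : ℝ) 1) :
    Integrable (fun z => |h z.1 - z.2|) P := by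
  refine Integrable.of_bound (C := 1)
    ((hm.comp measurable_fst).sub measurable_snd).abs.aestronglyMeasurable ?_
  filter_upwards [hP] with z hz
  rw [Real.norm_of_nonneg (abs_nonneg _)]
  exact abs_sub_le_of_nonneg_of_le (hr _).1 (hr _).2 hz.1 hz.2

lemma ae_pi_forall {Z : Type*} [MeasurableSpace Z] (P : Measure Z) [IsProbabilityMeasure P]
    {q : Z → Prop} (h : ∀ᵐ z ∂P, q z) : ∀ᵐ S ∂(Measure.pi fun _ : Fin N => P), ∀ i, q (S i) :=
  ae_all_iff.2 fun i =>
    (measurePreserving_eval (fun _ : Fin N => P) i).quasiMeasurePreserving.ae h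

/-- With `ε` as the rate of the exponential moment, growth function and tail multiply to at most
`p`. This `ε` is half the deviation term of the client error bound, where it is incurred twice. -/
lemma card_mul_exp_le {d : ℕ} (hN : 0 < N) {p : ℝ} (hp : p ∈ Set.Ioo (0 : ℝ) 1) {ε : ℝ}
    (hε : ε = 2 * √((2 * d * Real.log (2 * N) + Real.log (4 / p)) / N)) :
    ((2 * N + 1 : ℕ) ^ d : ℝ) * Real.exp (N * (ε ^ 2 / 2)) * Real.exp (-(ε * (N * ε))) ≤ p := by
  have hN' : (1 : ℝ) ≤ N := by exact_mod_cast hN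
  have hlogN : 0 ≤ Real.log (2 * N) := Real.log_nonneg (by linarith)
  have hlogp : 0 ≤ Real.log (4 / p) :=
    Real.log_nonneg (by rw [le_div_iff₀ hp.1]; linarith [hp.2])
  have hε2 : N * ε ^ 2 = 4 * (2 * d * Real.log (2 * N) + Real.log (4 / p)) := by
    rw [hε, mul_pow, Real.sq_sqrt (by positivity)]
    field_simp
    norm_num
  have h1 : Real.exp (N * (ε ^ 2 / 2)) * Real.exp (-(ε * (N * ε)))
      = (Real.exp (d * (4 * Real.log (2 * N))))⁻¹ * (Real.exp (Real.log (4 / p)) ^ 2)⁻¹ := by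
    rw [← Real.exp_add, ← Real.exp_nat_mul, ← Real.exp_neg, ← Real.exp_neg, ← Real.exp_add]
    congr 1
    push_cast
    linarith
  have h2 : Real.exp (d * (4 * Real.log (2 * N))) = ((2 * N : ℝ) ^ 4) ^ d := by
    rw [Real.exp_nat_mul]
    congr 1
    rw [← Real.exp_log (show (0 : ℝ) < 2 * N by linarith), ← Real.exp_nat_mul, Real.log_exp]
    norm_num
  have h3 : ((2 * N + 1 : ℕ) ^ d : ℝ) ≤ ((2 * N : ℝ) ^ 4) ^ d := by
    refine pow_le_pow_left₀ (by positivity) ?_ d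
    push_cast
    nlinarith [pow_le_pow_left₀ zero_le_one hN' 3, mul_nonneg (sub_nonneg.2 hN') (sub_nonneg.2 hN')]
  rw [mul_assoc, h1, h2, Real.exp_log (by have := hp.1; positivity), ← mul_assoc]
  have h4 : ((2 * N + 1 : ℕ) ^ d : ℝ) * (((2 * N : ℝ) ^ 4) ^ d)⁻¹ ≤ 1 := by
    rw [← div_eq_mul_inv]
    exact div_le_one_of_le₀ h3 (by positivity)
  have h5 : ((4 / p) ^ 2)⁻¹ ≤ p := by
    have := hp.1
    rw [div_pow, inv_div, div_le_iff₀ (by positivity)]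
    nlinarith [hp.2]
  calc _ ≤ 1 * ((4 / p) ^ 2)⁻¹ := mul_le_mul_of_nonneg_right h4 (by positivity)
    _ ≤ p := by rwa [one_mul]

/-- Uniform convergence of the empirical errors over a countable subfamily of the class. -/
lemma measure_exists_risk_deviation_le {κ : Type*} [Countable κ] (hm : ∀ h ∈ ℋ, Measurable h)
    (hr : ∀ h ∈ ℋ, ∀ x, h x ∈ Set.Icc (0 : ℝ) 1) {d : ℕ} (hd : vcDimension ℋ ≤ d)
    (P : Measure (X × ℝ)) [IsProbabilityMeasure P] (hP : ∀ᵐ z ∂P, z.2 ∈ Set.Icc (0 : ℝ) 1)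
    (hN : 0 < N) {p : ℝ} (hp : p ∈ Set.Ioo (0 : ℝ) 1) {h : κ → X → ℝ} (hh : ∀ k, h k ∈ ℋ) :
    (Measure.pi fun _ : Fin N => P) {S | ∃ k,
      2 * √((2 * d * Real.log (2 * N) + Real.log (4 / p)) / N) < risk (h k) P - empRisk (h k) S}
      ≤ ENNReal.ofReal p := by
  set ε := 2 * √((2 * d * Real.log (2 * N) + Real.log (4 / p)) / N) with hε
  have hN' : (1 : ℝ) ≤ N := by exact_mod_cast hN
  have hε0 : 0 < ε := by
    have h1 : 0 ≤ Real.log (2 * N) := Real.log_nonneg (by linarith)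
    have h2 : 0 < Real.log (4 / p) :=
      Real.log_pos (by rw [lt_div_iff₀ hp.1]; linarith [hp.2])
    positivity
  -- Labels are truncated to the unit interval, which changes them on a null set only.
  let v : X × ℝ → ℝ := fun z => max 0 (min 1 z.2)
  have hv : ∀ z, v z ∈ Set.Icc (0 : ℝ) 1 := fun z =>
    ⟨le_max_left _ _, max_le zero_le_one (min_le_left _ _)⟩
  have hvm : Measurable v := measurable_const.max (measurable_const.min measurable_snd)
  have hveq : ∀ z : X × ℝ, z.2 ∈ Set.Icc (0 : ℝ) 1 → v z = z.2 := fun z hz => by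
    simp only [v]; rw [min_eq_right hz.2, max_eq_right hz.1]
  have key := measure_exists_deviation_le (N := N) P (φ := fun k z => |h k z.1 - v z|)
    (c := ε) (ε := ε) (M := (2 * N + 1 : ℕ) ^ d * Real.exp (N * (ε ^ 2 / 2)))
    (fun k => (((hm _ (hh k)).comp measurable_fst).sub hvm).abs)
    (fun k z => ⟨abs_nonneg _,
      abs_sub_le_of_nonneg_of_le (hr _ (hh k) _).1 (hr _ (hh k) _).2 (hv z).1 (hv z).2⟩) hε0 hN ?_
  · refine le_trans (measure_mono_ae ?_) (key.trans (ENNReal.ofReal_le_ofReal ?_))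
    · filter_upwards [ae_pi_forall (N := N) P hP] with S hS
      rintro ⟨k, hk⟩
      refine ⟨k, ?_⟩
      have h1 : ∫ z, |h k z.1 - v z| ∂P = risk (h k) P := by
        refine integral_congr_ae ?_
        filter_upwards [hP] with z hz
        rw [hveq z hz]
      have h2 : (∑ i, |h k (S i).1 - v (S i)|) / N = empRisk (h k) S := by
        rw [empRisk]
        congr 1
        exact Finset.sum_congr rfl fun i _ => by rw [hveq _ (hS i)]
      simp only [h1, h2]
      exact hk
    · exact card_mul_exp_le hN hp hε
  · intro ω
    let w : Fin N × Bool → X × ℝ := fun j => if j.2 then (ω j.1).2 else (ω j.1).1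
    obtain ⟨B, hB1, hB2⟩ := exists_majorant (traces (decisionRegions ℋ) fun j => (w j).1)
      (u := fun k j => h k (w j).1) (v := fun j => v (w j)) (fun k j => hr _ (hh k) _)
      (fun j => hv _) (fun k β hβ => by
        classical
        refine ⟨Finset.univ.filter fun j => β < h k (w j).1, ?_, by simp⟩
        simp only [traces, Finset.mem_filter, Finset.mem_univ, true_and]
        exact ⟨_, ⟨h k, hh k, β, hβ.1, hβ.2, rfl⟩, fun j => Iff.rfl⟩) ε
    refine ⟨B, fun σ k => by simpa [w] using hB1 σ k, hB2.trans ?_⟩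
    rw [Fintype.card_fin]
    have hcard := card_traces_le hd (𝒞 := decisionRegions ℋ) fun j => (w j).1
    rw [Fintype.card_prod, Fintype.card_fin, Fintype.card_bool, mul_comm N 2] at hcard
    gcongr
    exact_mod_cast hcard

lemma integral_empRisk (P : Measure (X × ℝ)) [IsProbabilityMeasure P] (hN : 0 < N) {h : X → ℝ}
    (hm : Measurable h) (hr : ∀ x, h x ∈ Set.Icc (0 : ℝ) 1)
    (hP : ∀ᵐ z ∂P, z.2 ∈ Set.Icc (0 : ℝ) 1) :
    ∫ S, empRisk h S ∂(Measure.pi fun _ : Fin N => P) = risk h P := by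
  have hi := integrable_loss P hm hr hP
  have hN' : (N : ℝ) ≠ 0 := Nat.cast_ne_zero.2 hN.ne'
  unfold empRisk
  rw [integral_div, integral_finsetSum _ fun i _ => by
    exact (measurePreserving_eval (fun _ : Fin N => P) i).integrable_comp_of_integrable hi]
  have h1 : ∀ i : Fin N, ∫ S : Fin N → X × ℝ, |h (S i).1 - (S i).2| ∂(Measure.pi fun _ => P)
      = risk h P := by
    intro i
    have h4 := (measurePreserving_eval (fun _ : Fin N => P) i).map_eq
    change Measure.map (fun S : Fin N → X × ℝ => S i) _ = P at h4
    have h3 := integral_map (μ := Measure.pi fun _ : Fin N => P) (f := fun z => |h z.1 - z.2|)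
      (measurable_pi_apply i).aemeasurable (by rw [h4]; exact hi.aestronglyMeasurable)
    rw [h4] at h3
    exact h3.symm
  simp_rw [h1]
  simp [hN']

lemma empRisk_mem_Icc {Y : Type*} {h : Y → ℝ} (hr : ∀ x, h x ∈ Set.Icc (0 : ℝ) 1)
    {S : Fin N → Y × ℝ} (hS : ∀ i, (S i).2 ∈ Set.Icc (0 : ℝ) 1) :
    empRisk h S ∈ Set.Icc (0 : ℝ) 1 := by
  refine ⟨by unfold empRisk; positivity, div_le_one_of_le₀ ?_ (Nat.cast_nonneg N)⟩
  refine (Finset.sum_le_card_nsmul _ _ 1 fun i _ => ?_).trans_eq (by simp)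
  exact abs_sub_le_of_nonneg_of_le (hr _).1 (hr _).2 (hS i).1 (hS i).2

/-- If the empirical error is almost surely continuous in the parameter, then so is its mean, the
generalization error. -/
lemma continuous_risk {E : Type*} [TopologicalSpace E] [FirstCountableTopology E]
    (P : Measure (X × ℝ)) [IsProbabilityMeasure P] (hP : ∀ᵐ z ∂P, z.2 ∈ Set.Icc (0 : ℝ) 1)
    (hN : 0 < N) {f : E → X → ℝ} (hm : ∀ θ, Measurable (f θ))
    (hr : ∀ θ x, f θ x ∈ Set.Icc (0 : ℝ) 1)
    (hcont : ∀ᵐ S ∂(Measure.pi fun _ : Fin N => P), Continuous fun θ => empRisk (f θ) S) :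
    Continuous fun θ => risk (f θ) P := by
  simp_rw [← fun θ => integral_empRisk P hN (hm θ) (hr θ) hP]
  refine continuous_of_dominated (bound := fun _ => 1) (fun θ => ?_) (fun θ => ?_)
    (integrable_const _) hcont
  · refine Measurable.aestronglyMeasurable (Measurable.div_const
      (Finset.measurable_sum _ fun i _ => ?_) _)
    have h1 := ((hm θ).comp measurable_fst).sub measurable_snd
    exact (h1.comp (measurable_pi_apply i)).abs
  · filter_upwards [ae_pi_forall (N := N) P hP] with S hS
    have := empRisk_mem_Icc (hr θ) hS
    rw [Real.norm_of_nonneg this.1]; exact this.2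

/-- Uniform convergence over an uncountable family whose empirical error is almost surely continuous
in the parameter: a countable dense set of parameters suffices. The exceptional set need not be
measurable; its outer measure is bounded. -/
lemma measure_exists_risk_deviation_le_of_continuous {E : Type*} [TopologicalSpace E]
    [SecondCountableTopology E] [Nonempty E] (hm : ∀ h ∈ ℋ, Measurable h)
    (hr : ∀ h ∈ ℋ, ∀ x, h x ∈ Set.Icc (0 : ℝ) 1) {d : ℕ} (hd : vcDimension ℋ ≤ d)
    (P : Measure (X × ℝ)) [IsProbabilityMeasure P] (hP : ∀ᵐ z ∂P, z.2 ∈ Set.Icc (0 : ℝ) 1)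
    (hN : 0 < N) {p : ℝ} (hp : p ∈ Set.Ioo (0 : ℝ) 1) {f : E → X → ℝ} (hf : ∀ θ, f θ ∈ ℋ)
    (hcont : ∀ᵐ S ∂(Measure.pi fun _ : Fin N => P), Continuous fun θ => empRisk (f θ) S) :
    (Measure.pi fun _ : Fin N => P) {S | ∃ θ,
      2 * √((2 * d * Real.log (2 * N) + Real.log (4 / p)) / N) < risk (f θ) P - empRisk (f θ) S}
      ≤ ENNReal.ofReal p := by
  refine le_trans (measure_mono_ae ?_) (measure_exists_risk_deviation_le hm hr hd P hP hN hp
    (h := fun k => f (TopologicalSpace.denseSeq E k)) fun k => hf _)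
  have hrisk := continuous_risk P hP hN (fun θ => hm _ (hf θ)) (fun θ => hr _ (hf θ)) hcont
  filter_upwards [hcont] with S hS
  rintro ⟨θ, hθ⟩
  exact (TopologicalSpace.denseRange_denseSeq E).exists_mem_open
    (isOpen_lt continuous_const (hrisk.sub hS)) ⟨θ, hθ⟩

end UniformConvergence

/-! ### Mixtures -/

section Mixture

variable {Z : Type*} [MeasurableSpace Z] {R : ℕ} {α : Fin R → ℝ} {D : Fin R → Measure Z}

lemma isProbabilityMeasure_mixture [∀ r, IsProbabilityMeasure (D r)] (hα : ∀ r, 0 ≤ α r)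
    (hα_sum : ∑ r, α r = 1) : IsProbabilityMeasure (mixture α D) := by
  constructor
  simp only [mixture, Measure.coe_finsetSum, Finset.sum_apply, Measure.smul_apply, measure_univ,
    smul_eq_mul, mul_one]
  rw [← ENNReal.ofReal_sum_of_nonneg fun r _ => hα r, hα_sum, ENNReal.ofReal_one]

lemma ae_mixture {q : Z → Prop} (h : ∀ r, ∀ᵐ z ∂(D r), q z) : ∀ᵐ z ∂(mixture α D), q z := by
  rw [ae_iff]
  simp only [mixture, Measure.coe_finsetSum, Finset.sum_apply, Measure.smul_apply, smul_eq_mul]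
  exact Finset.sum_eq_zero fun r _ => by rw [ae_iff.1 (h r), mul_zero]

lemma integral_mixture (hα : ∀ r, 0 ≤ α r) {g : Z → ℝ} (hg : ∀ r, Integrable g (D r)) :
    ∫ z, g z ∂(mixture α D) = ∑ r, α r * ∫ z, g z ∂(D r) := by
  rw [mixture, integral_finsetSum_measure fun r _ => (hg r).smul_measure ENNReal.ofReal_ne_top]
  refine Finset.sum_congr rfl fun r _ => ?_
  rw [integral_smul_measure, ENNReal.toReal_ofReal (hα r), smul_eq_mul]

end Mixture

/-! ### The client error -/

section Client

variable {X : Type*} [MeasurableSpace X] {ℋ : Set (X → ℝ)} {R : ℕ} {Dq : Fin R → Measure (X × ℝ)}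
  [∀ r, IsProbabilityMeasure (Dq r)] {α : Fin R → ℝ} {Dp : Measure (X × ℝ)}
  [IsProbabilityMeasure Dp]

/-- Transfer of the error from the mixture to the client by way of a second hypothesis `h'`, whose
disagreement with `h` is compared by the divergences. -/
lemma risk_client_le (hα : ∀ r, 0 ≤ α r) (hα_sum : ∑ r, α r = 1)
    (hDq : ∀ r, ∀ᵐ z ∂(Dq r), z.2 ∈ Set.Icc (0 : ℝ) 1)
    (hDp : ∀ᵐ z ∂Dp, z.2 ∈ Set.Icc (0 : ℝ) 1) (hm : ∀ h ∈ ℋ, Measurable h)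
    (hr : ∀ h ∈ ℋ, ∀ x, h x ∈ Set.Icc (0 : ℝ) 1) {h h' : X → ℝ} (hh : h ∈ ℋ) (hh' : h' ∈ ℋ) :
    risk h Dp ≤ risk h' Dp + risk h (mixture α Dq) + risk h' (mixture α Dq)
      + 1 / 2 * ∑ r, α r * hdhDivergence ℋ (Dq r) Dp := by
  have := isProbabilityMeasure_mixture (D := Dq) hα hα_sum
  have hlm : ∀ (D : Measure (X × ℝ)) [IsProbabilityMeasure D],
      Integrable (fun z => |h z.1 - h' z.1|) D := by
    intro D _
    refine Integrable.of_bound (C := 1) (((hm h hh).comp measurable_fst).sub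
      ((hm h' hh').comp measurable_fst)).abs.aestronglyMeasurable (ae_of_all _ fun z => ?_)
    rw [Real.norm_of_nonneg (abs_nonneg _)]
    exact abs_sub_le_of_nonneg_of_le (hr h hh _).1 (hr h hh _).2 (hr h' hh' _).1 (hr h' hh' _).2
  have hloss : ∀ (D : Measure (X × ℝ)) [IsProbabilityMeasure D],
      (∀ᵐ z ∂D, z.2 ∈ Set.Icc (0 : ℝ) 1) → ∀ g ∈ ℋ, Integrable (fun z => |g z.1 - z.2|) D :=
    fun D _ hD g hg => integrable_loss D (hm g hg) (hr g hg) hD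
  have hQ := ae_mixture (α := α) hDq
  have h1 : risk h Dp ≤ risk h' Dp + ∫ z, |h z.1 - h' z.1| ∂Dp := by
    unfold risk
    rw [← integral_add (hloss Dp hDp h' hh') (hlm Dp)]
    refine integral_mono (hloss Dp hDp h hh) ((hloss Dp hDp h' hh').add (hlm Dp)) fun z => ?_
    have := abs_sub_le (h z.1) (h' z.1) z.2
    simp only
    linarith
  have h2 : ∫ z, |h z.1 - h' z.1| ∂(mixture α Dq)
      ≤ risk h (mixture α Dq) + risk h' (mixture α Dq) := by
    unfold risk
    rw [← integral_add (hloss _ hQ h hh) (hloss _ hQ h' hh')]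
    refine integral_mono (hlm _) ((hloss _ hQ h hh).add (hloss _ hQ h' hh')) fun z => ?_
    have := abs_sub_le (h z.1) z.2 (h' z.1)
    rw [abs_sub_comm z.2] at this
    exact this
  have h3 : ∫ z, |h z.1 - h' z.1| ∂Dp ≤ ∫ z, |h z.1 - h' z.1| ∂(mixture α Dq)
      + 1 / 2 * ∑ r, α r * hdhDivergence ℋ (Dq r) Dp := by
    rw [integral_mixture hα fun r => hlm (Dq r), Finset.mul_sum, ← Finset.sum_add_distrib]
    calc ∫ z, |h z.1 - h' z.1| ∂Dp = ∑ r, α r * ∫ z, |h z.1 - h' z.1| ∂Dp := by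
          rw [← Finset.sum_mul, hα_sum, one_mul]
      _ ≤ _ := Finset.sum_le_sum fun r _ => by
          have := mul_le_mul_of_nonneg_left (integral_disagreement_le hm hr Dp (Dq r) hh hh') (hα r)
          linarith
  linarith

end Client

end ClientError

theorem mainTheorem3
    {X : Type*} [MeasurableSpace X]
    -- cluster distributions, mixture weights, client distribution
    (R : ℕ) (Dq : Fin R → Measure (X × ℝ)) [∀ r, IsProbabilityMeasure (Dq r)]
    (α : Fin R → ℝ) (hα : ∀ r, α r ∈ Set.Icc (0 : ℝ) 1) (hα_sum : ∑ r, α r = 1)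
    (Dp : Measure (X × ℝ)) [IsProbabilityMeasure Dp]
    -- labels lie in `[0, 1]`
    (hDq : ∀ r, ∀ᵐ z ∂(Dq r), z.2 ∈ Set.Icc (0 : ℝ) 1)
    (hDp : ∀ᵐ z ∂Dp, z.2 ∈ Set.Icc (0 : ℝ) 1)
    -- hypothesis space of VC dimension `d`
    (ℋ : Set (X → ℝ)) (hℋ_meas : ∀ h ∈ ℋ, Measurable h)
    (hℋ_range : ∀ h ∈ ℋ, ∀ x, h x ∈ Set.Icc (0 : ℝ) 1)
    (d : ℕ) (hd : ClientError.vcDimension ℋ = d)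
    -- the parametrized model, with parameter domain `Θ`
    (m : ℕ) (Θ : Set (EuclideanSpace ℝ (Fin m))) (f : EuclideanSpace ℝ (Fin m) → X → ℝ)
    (hf : ∀ θ ∈ Θ, f θ ∈ ℋ)
    (N : ℕ) (hN : 0 < N) (p : ℝ) (hp : p ∈ Set.Ioo (0 : ℝ) 1)
    -- gradient descent
    (μ G η : ℝ) (hμ : 0 < μ) (hG : 0 < G) (hη : 0 < η) (hηG : η ≤ 1 / G)
    (θ₀ : EuclideanSpace ℝ (Fin m)) (hθ₀ : θ₀ ∈ Θ) (T : ℕ)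
    (hconvex : ∀ᵐ S ∂(Measure.pi fun _ : Fin N => ClientError.mixture α Dq),
      StrongConvexOn Θ μ (ClientError.trainLoss f S))
    (hsmooth : ∀ᵐ S ∂(Measure.pi fun _ : Fin N => ClientError.mixture α Dq),
      ClientError.IsSmoothOn Θ G (ClientError.trainLoss f S))
    (hiter : ∀ᵐ S ∂(Measure.pi fun _ : Fin N => ClientError.mixture α Dq),
      ∀ t ≤ T, ClientError.gradDescent (ClientError.trainLoss f S) η θ₀ t ∈ Θ) :
    (Measure.pi fun _ : Fin N => ClientError.mixture α Dq)
      {S | ¬ (ClientError.risk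
            (f (ClientError.gradDescent (ClientError.trainLoss f S) η θ₀ T)) Dp
          ≤ (1 - μ * η) ^ T * ClientError.initialGap f Θ θ₀ S
            + 1 / 2 * ∑ r, α r * ClientError.hdhDivergence ℋ (Dq r) Dp
            + 4 * √((2 * d * Real.log (2 * N) + Real.log (4 / p)) / N)
            + ClientError.xiPrime f Θ S Dp)}
      ≤ ENNReal.ofReal p := by
  open ClientError in
  have hα0 : ∀ r, 0 ≤ α r := fun r => (hα r).1
  have := isProbabilityMeasure_mixture (D := Dq) hα0 hα_sum
  have hQ := ae_mixture (α := α) hDq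
  have : Nonempty Θ := ⟨⟨θ₀, hθ₀⟩⟩
  refine le_trans (measure_mono_ae ?_) (measure_exists_risk_deviation_le_of_continuous (E := Θ)
    hℋ_meas hℋ_range hd.le (mixture α Dq) hQ hN hp (f := fun θ => f θ) (fun θ => hf θ θ.2) ?_)
  · filter_upwards [hconvex, hsmooth, hiter] with S hc hs hi
    intro hbad
    by_contra hdev
    refine hbad ?_
    have hdev : ∀ θ : Θ, risk (f θ) (mixture α Dq) - empRisk (f θ) S
        ≤ 2 * √((2 * d * Real.log (2 * N) + Real.log (4 / p)) / N) :=
      fun θ => not_lt.1 fun h => hdev ⟨θ, h⟩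
    set θT := gradDescent (trainLoss f S) η θ₀ T
    have hnn : ∀ θ, 0 ≤ trainLoss f S θ := fun θ => by
      unfold trainLoss empRisk; positivity
    have hle : ∀ θ ∈ Θ, optLoss f Θ S ≤ trainLoss f S θ := fun θ hθ =>
      ciInf_le (f := fun θ : Θ => trainLoss f S θ) ⟨0, by rintro _ ⟨θ, rfl⟩; exact hnn θ⟩ ⟨θ, hθ⟩
    have hgap := gradDescent_gap_le hc hs hμ hG hη hηG hi hle
      fun b hb => le_ciInf fun θ : Θ => hb θ θ.2
    have habs : initialGap f Θ θ₀ S = trainLoss f S θ₀ - optLoss f Θ S :=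
      abs_of_nonneg (sub_nonneg.2 (hle θ₀ hθ₀))
    -- Both `f θT` and the comparison hypothesis `f θ` incur the deviation once.
    have hcomp : ∀ θ : Θ, risk (f θT) Dp - trainLoss f S θT
        - 1 / 2 * ∑ r, α r * hdhDivergence ℋ (Dq r) Dp
        - 4 * √((2 * d * Real.log (2 * N) + Real.log (4 / p)) / N)
        ≤ trainLoss f S θ + risk (f θ) Dp := by
      intro θ
      have h1 := risk_client_le hα0 hα_sum hDq hDp hℋ_meas hℋ_range (hf θT (hi T le_rfl))
        (hf θ θ.2)
      have h2 := hdev ⟨θT, hi T le_rfl⟩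
      have h3 := hdev θ
      unfold trainLoss
      linarith
    have hinf := le_ciInf hcomp
    rw [habs, xiPrime]
    linarith
  · filter_upwards [hsmooth] with S hs
    have hcont : ContinuousOn (trainLoss f S) Θ := fun θ hθ =>
      (hs.1 θ hθ).continuousAt.continuousWithinAt
    exact hcont.domRestrict
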